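/- For a nonnegative integer $n$ let $$G_n(x,z)=\sum_{k=0}^{\lfloor n/2\rfloor}(-1)^k\,\frac{\prod_{i=0}^{n-k-1}(z+i)}{k!\,(n-2k)!}\,(2x)^{n-2k}$$ be the Gegenbauer polynomial of degree $n$ with parameter $z$. For every fixed $x\in[-1,1]$, the polynomial $G_n(x,z)$ in the variable $z$ splits into linear factors over $\mathbb R$ (it is real-rooted; the zero polynomial, which occurs only for $x=0$ and $n$ odd, is counted as real-rooted by convention), and for $x\neq0$ its degree in $z$ is exactly $n$. At $x=0$: if $n$ is even, $G_n(0,z)$ has degree $n/2$ and its roots are $0,-1,\dots,-(n/2-1)$, all simple; if $n$ is odd, $G_n(0,z)$ is the zero polynomial. Moreover, there are functions $\gamma_1,\dots,\gamma_{\lfloor n/2\rfloor}$, real-valued and continuous on each of $[-1,0)$ and $(0,1]$, such that for every $x\in[-1,1]$ with $x\ne0$ the roots of $G_n(x,z)$ in $z$, counted with multiplicity, are the $\lceil n/2\rceil$ constant ones $0,-1,\dots,-(\lceil n/2\rceil-1)$ together with $\gamma_1(x),\dots,\gamma_{\lfloor n/2\rfloor}(x)$, the latter being pairwise distinct. Each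 $\gamma_i$ is strictly increasing on $[-1,0)$ and strictly decreasing on $(0,1]$, and $\gamma_i(x)\to+\infty$ as $x\to0$ from either side. -/

import Mathlib

open Polynomial Filter Topology

/-- The value `G_n(x, z)` of the Gegenbauer polynomial of degree `n` with parameter `z` at `x`:
`∑_{k ≤ ⌊n/2⌋} (-1)^k (z)(z+1)⋯(z+n-k-1) / (k! (n-2k)!) (2x)^(n-2k)`. -/
noncomputable def gegenbauer (n : ℕ) (x z : ℝ) : ℝ :=
  ∑ k ∈ Finset.range (n / 2 + 1),
    (-1) ^ k * (∏ i ∈ Finset.range (n - k), (z + (i : ℝ))) /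
      ((k.factorial : ℝ) * ((n - 2 * k).factorial : ℝ)) * (2 * x) ^ (n - 2 * k)

/-- For fixed `x`, the Gegenbauer polynomial `G_n(x, z)` as a polynomial in the parameter `z`. -/
noncomputable def gegenbauerInParam (n : ℕ) (x : ℝ) : ℝ[X] :=
  ∑ k ∈ Finset.range (n / 2 + 1),
    C ((-1) ^ k / ((k.factorial : ℝ) * ((n - 2 * k).factorial : ℝ)) * (2 * x) ^ (n - 2 * k)) *
      ∏ i ∈ Finset.range (n - k), (X + C (i : ℝ))

theorem eval_gegenbauerInParam (n : ℕ) (x z : ℝ) :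
    (gegenbauerInParam n x).eval z = gegenbauer n x z := by
  simp only [gegenbauerInParam, gegenbauer, eval_finsetSum, eval_mul, eval_prod, eval_add, eval_X,
    eval_C]
  refine Finset.sum_congr rfl fun k _ => ?_
  ring

/-!
Write `n = 2 m + ε` with `ε ∈ {0, 1}`. Reversing the sum that defines `G_n(x, z)` gives
`G_n(x, z) = const · (2x)^ε · z (z + 1) ⋯ (z + m + ε - 1) · M_m(z + m + ε)`, where
`M_m(w) = ₂F₁(-m, w; c; t)` with `c = ε + 1/2` and `t = x²`
(`gegenbauerInParam_two_mul_add`). The linear factors are the constant roots; the moving ones come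
from `M_m`, a Meixner polynomial in disguise, with `0 < t ≤ 1`.

All that is needed about `M_m` follows from its three-term recurrence `meixner_succ_succ` and from
`t ∂M_m/∂t = m (M_m - M_{m-1})` (`hasDerivAt_eval_meixner`).

* By the recurrence, `Im (M_{m+1}(w) * conj M_m(w))` is negative for `Im w > 0`, so all roots are
  real (`im_aeval_meixner_mul_conj_neg`).
* The Wronskian `M_{m+1}' M_m - M_{m+1} M_m'` is negative for `t < 1`, so the roots are simple
  (`wronskian_meixner_neg`); for `t = 1` simplicity is checked directly.
* The increasingly ordered simple roots are continuous in `t`, and their derivatives are given by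
  implicit differentiation. At a root, `t ∂M_m/∂t = -m M_{m-1}`, which has the sign of `∂M_m/∂w` by
  the Wronskian inequality, so every root decreases strictly in `t` (`exists_root_curves_meixner`).
* At `t = 0` the polynomial is the constant `1`, so by compactness the roots escape to `+∞`.
-/

/-! ### Meixner polynomials -/

/-- The `j`-th term `(-t)^j (X)_j / (c)_j` out of which the Meixner polynomials are built. -/
noncomputable def meixnerTerm (c t : ℝ) (j : ℕ) : ℝ[X] :=
  C ((-t) ^ j / (ascPochhammer ℝ j).eval c) * ascPochhammer ℝ j

/-- The terminating hypergeometric series `₂F₁(-m, X; c; t) = ∑ⱼ (m choose j) (-t)^j (X)_j / (c)_j`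
as a polynomial in its second numerator parameter. For `0 < t < 1` and `X = x + c` it is, up to the
factor `(1 - t)^m`, the Meixner polynomial of degree `m` in `x`, which is orthogonal for the weight
`(c)ₓ (1 - t)^x / x!` on the natural numbers. -/
noncomputable def meixner (c t : ℝ) (m : ℕ) : ℝ[X] :=
  ∑ j ∈ Finset.range (m + 1), C (m.choose j : ℝ) * meixnerTerm c t j

theorem sub_mul_choose_succ (m j : ℕ) :
    ((m + 1 : ℝ) - j) * ((m + 1).choose j : ℝ) = (m + 1) * (m.choose j : ℝ) := by
  rcases le_or_gt j (m + 1) with h | h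
  · have h3 : (m.choose j : ℝ) * (m + 1) = ((m + 1).choose j : ℝ) * ((m + 1 - j : ℕ) : ℝ) := by
      exact_mod_cast Nat.choose_mul_succ_eq m j
    rw [Nat.cast_sub h] at h3
    push_cast at h3
    linear_combination -h3
  · rw [Nat.choose_eq_zero_of_lt h, Nat.choose_eq_zero_of_lt (by omega)]; simp

theorem meixner_eq_sum_range (c t : ℝ) {m N : ℕ} (h : m < N) :
    meixner c t m = ∑ j ∈ Finset.range N, C (m.choose j : ℝ) * meixnerTerm c t j := by
  refine Finset.sum_subset (Finset.range_mono h) fun j _ hj => ?_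
  rw [Nat.choose_eq_zero_of_lt (by simpa using hj)]
  simp

theorem meixner_zero (c t : ℝ) : meixner c t 0 = 1 := by
  simp [meixner, meixnerTerm]

/-- Multiplication by `t X` on the terms, from `X (X)_j = (X)_{j+1} - j (X)_j`. -/
theorem C_mul_X_mul_meixnerTerm {c : ℝ} (hc : 0 < c) (t : ℝ) (j : ℕ) :
    C t * X * meixnerTerm c t j
      = -(C (c + j) * meixnerTerm c t (j + 1)) - C (j * t) * meixnerTerm c t j := by
  have h : (ascPochhammer ℝ j).eval c ≠ 0 := (ascPochhammer_pos j c hc).ne'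
  have h' : c + j ≠ 0 := by positivity
  have h1 : C (c + j) * C ((-t) ^ (j + 1) / ((ascPochhammer ℝ j).eval c * (c + j)))
      = -(C t * C ((-t) ^ j / (ascPochhammer ℝ j).eval c)) := by
    rw [← C_mul, ← C_mul, ← C_neg]
    congr 1
    field_simp
    ring
  simp only [meixnerTerm, ascPochhammer_succ_eval]
  rw [ascPochhammer_succ_right, ← mul_assoc (C (c + j)), h1, C_mul]
  simp only [C_eq_natCast]
  ring

/-- The three-term recurrence in the degree; it drives all the positivity arguments. -/
theorem meixner_succ_succ {c : ℝ} (hc : 0 < c) (t : ℝ) (m : ℕ) :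
    C (c + (m + 1 : ℕ)) * meixner c t (m + 2)
      = (C (2 * (m + 1 : ℕ) + c - (m + 1 : ℕ) * t) - C t * X) * meixner c t (m + 1)
        - C ((m + 1 : ℕ) * (1 - t)) * meixner c t m := by
  have hX : C t * X * meixner c t (m + 1)
      = -(∑ j ∈ Finset.range (m + 3), C (((m + 1).choose j : ℝ) * (c + j)) *
            meixnerTerm c t (j + 1))
        - ∑ j ∈ Finset.range (m + 3), C (((m + 1).choose j : ℝ) * (j * t)) *
            meixnerTerm c t j := by
    rw [meixner_eq_sum_range c t (show m + 1 < m + 3 by omega), Finset.mul_sum,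
      ← Finset.sum_neg_distrib, ← Finset.sum_sub_distrib]
    refine Finset.sum_congr rfl fun j _ => ?_
    rw [mul_left_comm, C_mul_X_mul_meixnerTerm hc]
    simp only [C_mul]
    ring
  rw [sub_mul, hX]
  -- after this shift of the index, the identity reduces to one between the coefficients
  have hshift : ∑ j ∈ Finset.range (m + 3), C (((m + 1).choose j : ℝ) * (c + j)) *
      meixnerTerm c t (j + 1)
      = ∑ j ∈ Finset.range (m + 3), C ((j : ℝ) / (m + 2) * ((m + 2).choose j : ℝ) *
        (c + j - 1)) * meixnerTerm c t j := by
    rw [Finset.sum_range_succ, Finset.sum_range_succ' _ (m + 2)]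
    rw [Nat.choose_eq_zero_of_lt (by omega : m + 1 < m + 2)]
    simp only [Nat.cast_zero, zero_mul, zero_div, C_0, add_zero]
    refine Finset.sum_congr rfl fun j _ => ?_
    have h := Nat.add_one_mul_choose_eq (m + 1) j
    have h' : ((m : ℝ) + 2) * ((m + 1).choose j : ℝ) = ((m + 2).choose (j + 1) : ℝ) * (j + 1) := by
      exact_mod_cast h
    congr 2
    push_cast
    field_simp
    linear_combination (c + j) * h'
  rw [hshift, meixner_eq_sum_range c t (show m + 2 < m + 3 by omega),
    meixner_eq_sum_range c t (show m + 1 < m + 3 by omega),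
    meixner_eq_sum_range c t (show m < m + 3 by omega)]
  simp only [Finset.mul_sum, ← Finset.sum_sub_distrib, ← Finset.sum_neg_distrib]
  refine Finset.sum_congr rfl fun j _ => ?_
  simp only [← mul_assoc, ← C_mul, ← sub_mul, ← neg_mul, ← C_neg, ← C_sub]
  congr 2
  -- both sides are expressed through `(m + 2).choose j`
  have h1 := sub_mul_choose_succ (m + 1) j
  have h2 := sub_mul_choose_succ m j
  push_cast at h1
  push_cast
  field_simp
  linear_combination (c + j + m + 1) * h1 + (m + 2) * (t - 1) * h2

theorem meixner_one_recurrence {c : ℝ} (hc : 0 < c) (t : ℝ) :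
    C c * meixner c t 1 = C c - C t * X := by
  have h := C_mul_X_mul_meixnerTerm hc t 0
  simp [meixnerTerm] at h
  have h2 : C c * C c⁻¹ = (1 : ℝ[X]) := by rw [← C_mul, mul_inv_cancel₀ hc.ne', C_1]
  simp [meixner, Finset.sum_range_succ, meixnerTerm, div_eq_mul_inv]
  linear_combination -C t * X * h2

/-- The derivative in the argument `t` lowers the degree. -/
theorem hasDerivAt_eval_meixner (c w : ℝ) {t : ℝ} (ht : t ≠ 0) (m : ℕ) :
    HasDerivAt (fun s => (meixner c s (m + 1)).eval w)
      ((m + 1) / t * ((meixner c t (m + 1)).eval w - (meixner c t m).eval w)) t := by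
  have key : ∀ j : ℕ, HasDerivAt (fun s => (C ((m + 1).choose j : ℝ) * meixnerTerm c s j).eval w)
      ((m + 1) / t * ((C ((m + 1).choose j : ℝ) * meixnerTerm c t j).eval w
        - (C (m.choose j : ℝ) * meixnerTerm c t j).eval w)) t := by
    intro j
    simp only [meixnerTerm, eval_mul, eval_C]
    have h2 := sub_mul_choose_succ m j
    have h3 := ((((hasDerivAt_id t).neg.pow j).div_const
      ((ascPochhammer ℝ j).eval c)).mul_const ((ascPochhammer ℝ j).eval w)).const_mul
        ((m + 1).choose j : ℝ)
    refine h3.congr_deriv ?_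
    have h4 : (j : ℝ) * (-t) ^ (j - 1) * t = -(j * (-t) ^ j) := by
      rcases j with _ | j
      · simp
      · simp [pow_succ, mul_assoc]
    rw [← mul_left_inj' ht]
    simp only [Pi.neg_apply, id]
    field_simp
    linear_combination (-((m + 1).choose j : ℝ) * eval w (ascPochhammer ℝ j) /
      eval c (ascPochhammer ℝ j)) * h4 - (-t) ^ j * eval w (ascPochhammer ℝ j) /
      eval c (ascPochhammer ℝ j) * h2
  have h := HasDerivAt.fun_sum (u := Finset.range (m + 2)) fun j _ => key j
  simp only [← Finset.mul_sum, Finset.sum_sub_distrib, ← eval_finsetSum] at h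
  rw [← meixner_eq_sum_range c t (show m < m + 2 by omega),
    ← meixner_eq_sum_range c t (show m + 1 < m + 2 by omega)] at h
  exact h

theorem natDegree_meixner {c : ℝ} (hc : 0 < c) {t : ℝ} (ht : t ≠ 0) (m : ℕ) :
    (meixner c t m).natDegree = m := by
  have hterm : ∀ j, (meixnerTerm c t j).degree = j := fun j => by
    have h : (-t) ^ j / (ascPochhammer ℝ j).eval c ≠ 0 :=
      div_ne_zero (pow_ne_zero _ (neg_ne_zero.2 ht)) (ascPochhammer_pos j c hc).ne'
    rw [meixnerTerm, degree_C_mul h, degree_eq_natDegree (monic_ascPochhammer ℝ j).ne_zero,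
      ascPochhammer_natDegree]
  apply natDegree_eq_of_degree_eq_some
  rw [meixner, Finset.sum_range_succ, degree_add_eq_right_of_degree_lt]
  · simp [hterm]
  · refine (degree_sum_le _ _).trans_lt ?_
    rw [Finset.sup_lt_iff (by simp [hterm])]
    intro j hj
    refine (degree_mul_le _ _).trans_lt ?_
    rw [hterm]
    refine (add_le_add_left degree_C_le _).trans_lt ?_
    simpa [hterm] using Finset.mem_range.1 hj

theorem continuous_eval_meixner (c : ℝ) (m : ℕ) :
    Continuous fun p : ℝ × ℝ => (meixner c p.1 m).eval p.2 := by
  simp only [meixner, meixnerTerm, eval_finsetSum, eval_mul, eval_C]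
  fun_prop

theorem eval_meixner_arg_zero (c w : ℝ) (m : ℕ) : (meixner c 0 m).eval w = 1 := by
  simp [meixner, meixnerTerm, Finset.sum_range_succ']

/-! ### Real and simple roots -/

/-- Along the recurrence `Im (M_{m+1}(w) * conj M_m(w))` stays negative in the upper half plane,
so no polynomial of the family vanishes there. -/
theorem im_aeval_meixner_mul_conj_neg {c t : ℝ} (hc : 0 < c) (ht0 : 0 < t) (ht1 : t ≤ 1) {w : ℂ}
    (hw : 0 < w.im) (m : ℕ) :
    (aeval w (meixner c t (m + 1)) * starRingEnd ℂ (aeval w (meixner c t m))).im < 0 := by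
  induction m with
  | zero =>
    have h := congrArg (aeval w) (meixner_one_recurrence hc t)
    simp only [map_mul, map_sub, aeval_C, aeval_X, Complex.coe_algebraMap] at h
    have h' := congrArg Complex.im h
    simp only [Complex.im_ofReal_mul, Complex.sub_im, Complex.ofReal_im] at h'
    simp only [zero_add, meixner_zero, map_one, mul_one]
    have : 0 < t * w.im := by positivity
    by_contra! h0
    have := mul_nonneg hc.le h0
    linarith
  | succ m ih =>
    set a := aeval w (meixner c t (m + 2))
    set b := aeval w (meixner c t (m + 1))
    set d := aeval w (meixner c t m)
    have hb0 : 0 < Complex.normSq b := by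
      refine Complex.normSq_pos.2 fun h => ?_
      rw [h] at ih
      simp at ih
    have h := congrArg (aeval w) (meixner_succ_succ hc t m)
    simp only [map_mul, map_sub, aeval_C, aeval_X, Complex.coe_algebraMap] at h
    have h1 : ((c + (m + 1 : ℕ) : ℝ) : ℂ) * (a * starRingEnd ℂ b)
        = ((2 * (m + 1 : ℕ) + c - (m + 1 : ℕ) * t : ℝ) - t * w) * (Complex.normSq b : ℂ)
          - ((m + 1 : ℕ) * (1 - t) : ℝ) * (d * starRingEnd ℂ b) := by
      rw [← Complex.mul_conj b]
      push_cast at h ⊢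
      linear_combination starRingEnd ℂ b * h
    have h2 : (d * starRingEnd ℂ b).im = -(b * starRingEnd ℂ d).im := by
      simp only [Complex.mul_im, Complex.conj_re, Complex.conj_im]
      ring
    have h3 := congrArg Complex.im h1
    rw [Complex.im_ofReal_mul, Complex.sub_im, Complex.im_ofReal_mul, h2, Complex.im_mul_ofReal,
      Complex.sub_im, Complex.ofReal_im, Complex.im_ofReal_mul] at h3
    have h4 : 0 < t * w.im * Complex.normSq b := by positivity
    have h5 : 0 ≤ ((m + 1 : ℕ) * (1 - t) : ℝ) :=
      mul_nonneg (Nat.cast_nonneg _) (by linarith)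
    have h6 := mul_nonneg h5 (neg_nonneg.2 ih.le)
    have h7 : 0 < c + (m + 1 : ℕ) := by positivity
    by_contra! h0
    have := mul_nonneg h7.le h0
    linarith

theorem splits_of_forall_aeval_ne_zero {p : ℝ[X]} (hp : ∀ w : ℂ, 0 < w.im → aeval w p ≠ 0) :
    p.Splits := by
  refine (IsAlgClosed.splits (p.map (algebraMap ℝ ℂ))).of_splits_map _ fun w hw => ?_
  have hw0 : aeval w p = 0 := by
    rw [← eval_map_algebraMap]
    exact isRoot_of_mem_roots hw
  have him : w.im = 0 := by
    rcases lt_trichotomy w.im 0 with h | h | h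
    · refine absurd ?_ (hp (starRingEnd ℂ w) (by simpa using h))
      rw [aeval_conj, hw0, map_zero]
    · exact h
    · exact absurd hw0 (hp w h)
  exact ⟨w.re, Complex.ext rfl (by simp [him])⟩

theorem splits_meixner {c t : ℝ} (hc : 0 < c) (ht0 : 0 < t) (ht1 : t ≤ 1) (m : ℕ) :
    (meixner c t m).Splits := by
  rcases m with _ | m
  · rw [meixner_zero]; exact Splits.one
  · refine splits_of_forall_aeval_ne_zero fun w hw h => ?_
    have := im_aeval_meixner_mul_conj_neg hc ht0 ht1 hw m
    rw [h] at this
    simp at this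

/-- The Wronskian of consecutive polynomials has constant sign. Consequently roots are simple, and
at a root of `M_{m+1}` the values `M_{m+1}'` and `M_m` have opposite signs. -/
theorem wronskian_meixner_neg {c t : ℝ} (hc : 0 < c) (ht0 : 0 < t) (ht1 : t < 1) (w : ℝ) (m : ℕ) :
    (derivative (meixner c t (m + 1))).eval w * (meixner c t m).eval w
      - (meixner c t (m + 1)).eval w * (derivative (meixner c t m)).eval w < 0 := by
  induction m with
  | zero =>
    have h := congrArg (fun p => (derivative p).eval w) (meixner_one_recurrence hc t)
    simp only [derivative_C_mul, derivative_sub, derivative_C, derivative_X, eval_mul, eval_sub,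
      eval_C, eval_zero, eval_one] at h
    simp only [zero_add, meixner_zero, eval_one, derivative_one, eval_zero]
    by_contra! h0
    have := mul_nonneg hc.le h0
    linarith
  | succ m ih =>
    have h := congrArg (eval w) (meixner_succ_succ hc t m)
    have h' := congrArg (fun p => (derivative p).eval w) (meixner_succ_succ hc t m)
    simp only [derivative_mul, derivative_sub, derivative_C, derivative_X, eval_mul, eval_sub,
      eval_add, eval_C, eval_zero, eval_one, eval_X] at h h'
    set a := (meixner c t (m + 2)).eval w
    set b := (meixner c t (m + 1)).eval w
    have h5 : 0 < ((m + 1 : ℕ) * (1 - t) : ℝ) := mul_pos (by positivity) (by linarith)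
    have h6 := mul_pos h5 (neg_pos.2 ih)
    have h7 : 0 < c + (m + 1 : ℕ) := by positivity
    have h8 : 0 ≤ t * b ^ 2 := by positivity
    by_contra! h0
    have := mul_nonneg h7.le h0
    linarith [congrArg (· * b) h',
      congrArg (· * (derivative (meixner c t (m + 1))).eval w) h]

/-- For `t = 1` the recurrence degenerates to `(c + m) M_{m+1} = (c + m - X) M_m`, so the roots are
`c, c + 1, …`; only their simplicity is needed. -/
theorem derivative_ne_zero_of_eval_meixner_one_eq_zero {c : ℝ} (hc : 0 < c) (m : ℕ) {w : ℝ}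
    (hw : (meixner c 1 m).eval w = 0) :
    (derivative (meixner c 1 m)).eval w ≠ 0 ∧ w < c + m := by
  have hrec : ∀ m : ℕ, C (c + m) * meixner c 1 (m + 1) = (C (c + m) - X) * meixner c 1 m := by
    rintro (_ | m)
    · simpa [meixner_zero] using meixner_one_recurrence hc 1
    · have h := meixner_succ_succ hc 1 m
      rw [h]
      simp only [sub_self, mul_zero, C_0, zero_mul, sub_zero, C_1, one_mul]
      congr 3
      push_cast
      ring
  induction m with
  | zero => simp [meixner_zero] at hw
  | succ m ih =>
    have h := congrArg (eval w) (hrec m)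
    have h' := congrArg (fun p => (derivative p).eval w) (hrec m)
    simp only [derivative_mul, derivative_sub, derivative_C, derivative_X, eval_mul, eval_sub,
      eval_add, eval_neg, eval_C, eval_one, eval_X, hw, mul_zero, zero_mul, zero_add,
      zero_sub] at h h'
    push_cast
    rcases mul_eq_zero.1 h.symm with h0 | h0
    · have hne : (meixner c 1 m).eval w ≠ 0 := fun h1 => by linarith [(ih h1).2]
      refine ⟨fun hd => hne ?_, by linarith⟩
      rw [hd, h0] at h'
      linarith
    · obtain ⟨h1, h2⟩ := ih h0
      refine ⟨fun hd => ?_, by linarith⟩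
      rw [hd, h0, mul_zero, mul_zero, zero_add] at h'
      exact (mul_ne_zero (by linarith) h1) h'.symm

theorem derivative_ne_zero_of_eval_meixner_eq_zero {c t : ℝ} (hc : 0 < c) (ht0 : 0 < t)
    (ht1 : t ≤ 1) {m : ℕ} {w : ℝ} (hw : (meixner c t m).eval w = 0) :
    (derivative (meixner c t m)).eval w ≠ 0 := by
  rcases ht1.lt_or_eq with ht1 | rfl
  · rcases m with _ | m
    · simp [meixner_zero] at hw
    · intro h
      have := wronskian_meixner_neg hc ht0 ht1 w m
      rw [h, hw] at this
      simp at this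
  · exact (derivative_ne_zero_of_eval_meixner_one_eq_zero hc m hw).1

/-- The roots of `meixner c t m`, listed in increasing order. -/
theorem exists_strictMono_meixner_eq_prod {c t : ℝ} (hc : 0 < c) (ht0 : 0 < t) (ht1 : t ≤ 1)
    (m : ℕ) : ∃ r : Fin m → ℝ, StrictMono r ∧
      meixner c t m = C (meixner c t m).leadingCoeff * ∏ i, (X - C (r i)) := by
  have hs := splits_meixner hc ht0 ht1 m
  have hdeg := natDegree_meixner hc ht0.ne' m
  have hne : meixner c t m ≠ 0 := by
    rintro h
    rw [h, natDegree_zero] at hdeg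
    subst hdeg
    simp [meixner_zero] at h
  have hnd : (meixner c t m).roots.Nodup := by
    rw [Multiset.nodup_iff_count_le_one]
    intro w
    rw [count_roots]
    by_contra! h
    have := (one_lt_rootMultiplicity_iff_isRoot hne).1 h
    exact derivative_ne_zero_of_eval_meixner_eq_zero hc ht0 ht1 this.1 this.2
  have hcard : (meixner c t m).roots.toFinset.card = m := by
    rw [Multiset.toFinset_card_of_nodup hnd, ← hs.natDegree_eq_card_roots, hdeg]
  refine ⟨(meixner c t m).roots.toFinset.orderEmbOfFin hcard, OrderEmbedding.strictMono _, ?_⟩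
  conv_lhs => rw [hs.eq_prod_roots]
  congr 1
  have h1 : Finset.univ.map
      ((meixner c t m).roots.toFinset.orderEmbOfFin hcard).toEmbedding
      = (meixner c t m).roots.toFinset := Finset.map_orderEmbOfFin_univ _ hcard
  have h2 := Finset.prod_map Finset.univ
    ((meixner c t m).roots.toFinset.orderEmbOfFin hcard).toEmbedding fun a => X - C a
  rw [h1, Finset.prod, Multiset.toFinset_val, hnd.dedup] at h2
  exact h2

/-! ### Root curves -/

section RootCurves

variable {m : ℕ} {S : Set ℝ} {p : ℝ → ℝ[X]} {a : ℝ → ℝ} {r : Fin m → ℝ → ℝ}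

theorem StrictMono.eq_id_of_fin {σ : Fin m → Fin m} (h : StrictMono σ) : σ = id :=
  (h.range_inj strictMono_id).1 <| by
    rw [(Finite.surjective_of_injective h.injective).range_eq, Set.range_id]

/-- Sorted simple roots depend continuously on the parameter. Near a given parameter the polynomial
still changes sign across a small interval around each old root, so each of these intervals
contains a new root; the induced map of indices is strictly monotone, hence the identity. -/
theorem continuousOn_root_curve (hr : ∀ t ∈ S, StrictMono fun i => r i t)
    (hp : ∀ t ∈ S, p t = C (a t) * ∏ i, (X - C (r i t))) (ha : ∀ t ∈ S, a t ≠ 0)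
    (hcont : ∀ w, ContinuousOn (fun t => (p t).eval w) S) (i : Fin m) :
    ContinuousOn (r i) S := by
  have heval : ∀ t ∈ S, ∀ w, (p t).eval w = a t * ∏ k, (w - r k t) := fun t ht w => by
    rw [hp t ht, eval_mul, eval_C, eval_prod]
    simp
  have hmul : ∀ t ∈ S, ∀ u v, (p t).eval u * (p t).eval v
      = a t ^ 2 * ∏ k, ((u - r k t) * (v - r k t)) := fun t ht u v => by
    rw [heval t ht, heval t ht, Finset.prod_mul_distrib]
    ring
  intro t₀ ht₀
  rw [ContinuousWithinAt, Metric.tendsto_nhds]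
  intro ε hε
  obtain ⟨δ, hδ, hδε, hgap⟩ : ∃ δ : ℝ, 0 < δ ∧ δ < ε ∧
      ∀ k l : Fin m, k < l → 2 * δ < r l t₀ - r k t₀ := by
    have h1 : ∀ᶠ δ : ℝ in 𝓝[>] 0, 0 < δ := self_mem_nhdsWithin
    have h2 : ∀ᶠ δ : ℝ in 𝓝[>] 0, δ < ε := nhdsWithin_le_nhds (gt_mem_nhds hε)
    have h3 : ∀ᶠ δ : ℝ in 𝓝[>] 0, ∀ k l : Fin m, k < l → 2 * δ < r l t₀ - r k t₀ := by
      refine eventually_all.2 fun k => eventually_all.2 fun l => ?_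
      by_cases hkl : k < l
      · have hpos : 0 < (r l t₀ - r k t₀) / 2 := by linarith [hr t₀ ht₀ hkl]
        filter_upwards [nhdsWithin_le_nhds (gt_mem_nhds hpos)] with δ hδ _
        linarith
      · exact Eventually.of_forall fun _ h => absurd h hkl
    exact (h1.and (h2.and h3)).exists
  have hsign : ∀ j, (p t₀).eval (r j t₀ - δ) * (p t₀).eval (r j t₀ + δ) < 0 := by
    intro j
    rw [hmul t₀ ht₀, ← Finset.mul_prod_erase _ _ (Finset.mem_univ j)]
    have h1 : 0 < ∏ k ∈ Finset.univ.erase j,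
        ((r j t₀ - δ - r k t₀) * (r j t₀ + δ - r k t₀)) := by
      refine Finset.prod_pos fun k hk => ?_
      rcases lt_or_gt_of_ne (Finset.ne_of_mem_erase hk) with h | h
      · have := hgap _ _ h
        exact mul_pos (by linarith) (by linarith)
      · have := hgap _ _ h
        exact mul_pos_of_neg_of_neg (by linarith) (by linarith)
    have h2 : 0 < a t₀ ^ 2 := by have := ha t₀ ht₀; positivity
    refine mul_neg_of_pos_of_neg h2 (mul_neg_of_neg_of_pos ?_ h1)
    exact mul_neg_of_neg_of_pos (by linarith) (by linarith)
  have hev : ∀ᶠ t in 𝓝[S] t₀, ∀ j, (p t).eval (r j t₀ - δ) * (p t).eval (r j t₀ + δ) < 0 :=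
    eventually_all.2 fun j =>
      ((hcont _ t₀ ht₀).mul (hcont _ t₀ ht₀)).eventually (gt_mem_nhds (hsign j))
  filter_upwards [hev, self_mem_nhdsWithin] with t ht htS
  have hex : ∀ j, ∃ k, r j t₀ - δ < r k t ∧ r k t < r j t₀ + δ := by
    intro j
    by_contra! hno
    -- without a root in between, no factor of the product of the two values is negative
    refine absurd (ht j) (not_lt.2 ?_)
    rw [hmul t htS]
    refine mul_nonneg (sq_nonneg _) (Finset.prod_nonneg fun k _ => ?_)
    rcases lt_or_ge (r j t₀ - δ) (r k t) with h | h
    · have := hno k h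
      exact mul_nonneg_of_nonpos_of_nonpos (by linarith) (by linarith)
    · exact mul_nonneg (by linarith) (by linarith)
  choose σ hσ1 hσ2 using hex
  have hσ : StrictMono σ := fun k l hkl => by
    refine (hr t htS).lt_iff_lt.1 ?_
    linarith [hgap k l hkl, hσ2 k, hσ1 l]
  have hi : σ i = i := congrFun hσ.eq_id_of_fin i
  have h1 := hσ1 i
  have h2 := hσ2 i
  rw [hi] at h1 h2
  rw [Real.dist_eq, abs_lt]
  constructor <;> linarith

theorem HasDerivAt.mul_of_eq_zero {f g : ℝ → ℝ} {f' x : ℝ} (hf : HasDerivAt f f' x)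
    (hx : f x = 0) (hg : ContinuousAt g x) : HasDerivAt (fun y => f y * g y) (f' * g x) x := by
  rw [hasDerivAt_iff_tendsto_slope] at hf ⊢
  refine (hf.mul (hg.tendsto.mono_left nhdsWithin_le_nhds)).congr fun y => ?_
  simp only [slope_def_field, hx, zero_mul, sub_zero]
  ring

theorem eval_derivative_prod_X_sub_C (b : ℝ) (s : Fin m → ℝ) (i : Fin m) :
    (derivative (C b * ∏ k, (X - C (s k)))).eval (s i)
      = b * ∏ k ∈ Finset.univ.erase i, (s i - s k) := by
  rw [← Finset.mul_prod_erase _ _ (Finset.mem_univ i)]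
  simp [derivative_mul, eval_prod]

/-- The implicit differentiation formula for a root curve. It is read off from the factorisation,
which expresses `r i t - r i t₀` as the value of `p t` at `r i t₀` over a continuous
nonvanishing function. -/
theorem hasDerivAt_root_curve (hr : ∀ t ∈ S, StrictMono fun i => r i t)
    (hp : ∀ t ∈ S, p t = C (a t) * ∏ i, (X - C (r i t))) (ha : ∀ t ∈ S, a t ≠ 0)
    {t₀ : ℝ} (hS : S ∈ 𝓝 t₀) (hac : ContinuousAt a t₀) (hrc : ∀ i, ContinuousAt (r i) t₀)
    (i : Fin m) {p' : ℝ} (hp' : HasDerivAt (fun t => (p t).eval (r i t₀)) p' t₀) :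
    HasDerivAt (r i) (-(p' / (derivative (p t₀)).eval (r i t₀))) t₀ := by
  have ht₀ : t₀ ∈ S := mem_of_mem_nhds hS
  set D : ℝ → ℝ := fun t => a t * ∏ k ∈ Finset.univ.erase i, (r i t₀ - r k t) with hD
  have hDc : ContinuousAt D t₀ := by
    refine hac.mul ?_
    exact tendsto_finsetProd _ fun k _ => continuousAt_const.sub (hrc k)
  have hD₀ : D t₀ ≠ 0 := by
    refine mul_ne_zero (ha t₀ ht₀) (Finset.prod_ne_zero_iff.2 fun k hk => ?_)
    exact sub_ne_zero.2 fun h => Finset.ne_of_mem_erase hk ((hr t₀ ht₀).injective h.symm)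
  have hder : (derivative (p t₀)).eval (r i t₀) = D t₀ := by
    rw [hp t₀ ht₀]
    exact eval_derivative_prod_X_sub_C (a t₀) (fun k => r k t₀) i
  have heval : ∀ t ∈ S, (p t).eval (r i t₀) = (r i t₀ - r i t) * D t := fun t ht => by
    rw [hp t ht, eval_mul, eval_C, eval_prod, ← Finset.mul_prod_erase _ _ (Finset.mem_univ i)]
    simp only [eval_sub, eval_X, eval_C, hD]
    ring
  rw [hder]
  have h := ((hp'.mul_of_eq_zero (by rw [heval t₀ ht₀]; simp) (hDc.inv₀ hD₀)).const_sub (r i t₀))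
  rw [div_eq_mul_inv]
  refine h.congr_of_eventuallyEq ?_
  filter_upwards [hS, hDc.eventually_ne hD₀] with t ht htD
  rw [heval t ht, Pi.inv_apply]
  field_simp
  ring

end RootCurves

theorem continuousOn_leadingCoeff_meixner {c : ℝ} (hc : 0 < c) (m : ℕ) :
    ContinuousOn (fun t => (meixner c t m).leadingCoeff) (Set.Ioc 0 1) := by
  have h : Continuous fun t => (meixner c t m).coeff m := by
    simp only [meixner, meixnerTerm, finsetSum_coeff, coeff_C_mul]
    fun_prop
  refine h.continuousOn.congr fun t ht => ?_
  rw [leadingCoeff, natDegree_meixner hc ht.1.ne']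

/-- For `t ∈ (0, 1]` the roots of the Meixner polynomials form continuous curves, strictly
decreasing in `t` and escaping to `+∞` as `t → 0`. -/
theorem exists_root_curves_meixner {c : ℝ} (hc : 0 < c) (m : ℕ) :
    ∃ r : Fin m → ℝ → ℝ,
      (∀ t ∈ Set.Ioc (0 : ℝ) 1, StrictMono fun i => r i t) ∧
      (∀ t ∈ Set.Ioc (0 : ℝ) 1,
        meixner c t m = C (meixner c t m).leadingCoeff * ∏ i, (X - C (r i t))) ∧
      ∀ i, ContinuousOn (r i) (Set.Ioc 0 1) ∧ StrictAntiOn (r i) (Set.Ioc 0 1) ∧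
        Tendsto (r i) (𝓝[>] 0) atTop := by
  have hex : ∀ t : ℝ, ∃ r : Fin m → ℝ, t ∈ Set.Ioc (0 : ℝ) 1 → StrictMono r ∧
      meixner c t m = C (meixner c t m).leadingCoeff * ∏ i, (X - C (r i)) := by
    intro t
    by_cases ht : t ∈ Set.Ioc (0 : ℝ) 1
    · obtain ⟨r, hr⟩ := exists_strictMono_meixner_eq_prod hc ht.1 ht.2 m
      exact ⟨r, fun _ => hr⟩
    · exact ⟨0, fun h => absurd h ht⟩
  choose r' hr' using hex
  let r : Fin m → ℝ → ℝ := fun i t => r' t i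
  have hr : ∀ t ∈ Set.Ioc (0 : ℝ) 1, StrictMono fun i => r i t := fun t ht => (hr' t ht).1
  have hp : ∀ t ∈ Set.Ioc (0 : ℝ) 1,
      meixner c t m = C (meixner c t m).leadingCoeff * ∏ i, (X - C (r i t)) :=
    fun t ht => (hr' t ht).2
  have hroot : ∀ t ∈ Set.Ioc (0 : ℝ) 1, ∀ i, (meixner c t m).eval (r i t) = 0 := fun t ht i => by
    rw [hp t ht, eval_mul, eval_prod, Finset.prod_eq_zero (Finset.mem_univ i) (by simp), mul_zero]
  have ha : ∀ t ∈ Set.Ioc (0 : ℝ) 1, (meixner c t m).leadingCoeff ≠ 0 := fun t ht h => by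
    have hdeg := natDegree_meixner hc ht.1.ne' m
    rw [leadingCoeff_eq_zero.1 h, natDegree_zero] at hdeg
    subst hdeg
    simp [meixner_zero] at h
  have hcurve : ∀ w, Continuous fun t => (meixner c t m).eval w := fun w =>
    (continuous_eval_meixner c m).comp (Continuous.prodMk_left w)
  have hcont : ∀ i, ContinuousOn (r i) (Set.Ioc 0 1) :=
    continuousOn_root_curve hr hp ha fun w => (hcurve w).continuousOn
  have hanti : ∀ i, StrictAntiOn (r i) (Set.Ioc 0 1) := by
    intro i
    refine strictAntiOn_of_deriv_neg (convex_Ioc 0 1) (hcont i) fun t ht => ?_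
    rw [interior_Ioc] at ht
    have ht' : t ∈ Set.Ioc (0 : ℝ) 1 := Set.Ioo_subset_Ioc_self ht
    have hS : Set.Ioc (0 : ℝ) 1 ∈ 𝓝 t := Ioc_mem_nhds ht.1 ht.2
    obtain ⟨n, rfl⟩ : ∃ n, m = n + 1 := ⟨m - 1, by have := i.pos; omega⟩
    have hd := hasDerivAt_root_curve hr hp ha hS
      ((continuousOn_leadingCoeff_meixner hc (n + 1)).continuousAt hS)
      (fun k => (hcont k).continuousAt hS) i (hasDerivAt_eval_meixner c (r i t) ht.1.ne' n)
    have hW := wronskian_meixner_neg hc ht.1 ht.2 (r i t) n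
    rw [hroot t ht' i] at hW hd
    rw [hd.deriv, Left.neg_neg_iff]
    set u := (derivative (meixner c t (n + 1))).eval (r i t)
    set v := (meixner c t n).eval (r i t)
    have hu : u ≠ 0 := fun h => by simp [h] at hW
    have huv : 0 < -(u * v) := by linarith
    have ht0 := ht.1
    have : (n + 1) / t * (0 - v) / u = (n + 1) / t * -(u * v) / u ^ 2 := by
      field_simp
      ring
    rw [this]
    positivity
  refine ⟨r, hr, hp, fun i => ⟨hcont i, hanti i, ?_⟩⟩
  -- the roots are bounded below by their value at `t = 1`, and the limit polynomial at `t = 0`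
  -- is the constant `1`, so that no root stays in a compact interval
  rw [tendsto_atTop]
  intro R
  have hev : ∀ᶠ t in 𝓝 (0 : ℝ), ∀ w ∈ Set.Icc (r i 1) R, (meixner c t m).eval w ≠ 0 := by
    refine isCompact_Icc.eventually_forall_of_forall_eventually fun w _ => ?_
    exact (continuous_eval_meixner c m).continuousAt.eventually_ne
      (by simp [eval_meixner_arg_zero])
  filter_upwards [nhdsWithin_le_nhds hev, Ioc_mem_nhdsGT zero_lt_one] with t ht ht'
  by_contra! hlt
  exact ht (r i t) ⟨(hanti i).antitoneOn ht' ⟨zero_lt_one, le_rfl⟩ ht'.2, hlt.le⟩ (hroot t ht' i)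

/-! ### Gegenbauer polynomials in the parameter -/

/-- This identity fixes the parameter `c = ε + 1/2` of the Meixner polynomials involved. -/
theorem factorial_two_mul_add (ε j : ℕ) (hε : ε ≤ 1) :
    ((2 * j + ε).factorial : ℝ)
      = 4 ^ j * j.factorial * (ascPochhammer ℝ j).eval (ε + 1 / 2 : ℝ) := by
  induction j with
  | zero => interval_cases ε <;> simp
  | succ j ih =>
    rw [show 2 * (j + 1) + ε = 2 * j + ε + 1 + 1 by ring, Nat.factorial_succ, Nat.factorial_succ]
    push_cast
    rw [ih, ascPochhammer_succ_eval, Nat.factorial_succ]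
    push_cast
    interval_cases ε <;> push_cast <;> ring

theorem prod_range_add_X_add_C (a b : ℕ) :
    ∏ i ∈ Finset.range (a + b), (X + C (i : ℝ))
      = (∏ i ∈ Finset.range a, (X + C (i : ℝ))) * (ascPochhammer ℝ b).comp (X + C (a : ℝ)) := by
  induction b with
  | zero => simp
  | succ b ih =>
    rw [← add_assoc, Finset.prod_range_succ, ih, ascPochhammer_succ_right]
    simp only [mul_comp, add_comp, X_comp, natCast_comp, C_eq_natCast]
    push_cast
    ring

/-- Reversing the order of summation exhibits the Gegenbauer polynomial, as a polynomial in its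
parameter, as a product of the constant linear factors and a Meixner polynomial with
argument `x ^ 2`. -/
theorem gegenbauerInParam_two_mul_add (m ε : ℕ) (hε : ε ≤ 1) (x : ℝ) :
    gegenbauerInParam (2 * m + ε) x
      = C ((-1) ^ m * (2 * x) ^ ε / m.factorial) * (∏ i ∈ Finset.range (m + ε), (X + C (i : ℝ))) *
        (meixner (ε + 1 / 2) (x ^ 2) m).comp (X + C ((m + ε : ℕ) : ℝ)) := by
  rw [gegenbauerInParam, show (2 * m + ε) / 2 + 1 = m + 1 by omega, ← Finset.sum_range_reflect,
    meixner, ← coe_compRingHom_apply, map_sum, Finset.mul_sum]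
  refine Finset.sum_congr rfl fun j hj => ?_
  have hj : j ≤ m := by simpa [Nat.lt_succ_iff] using hj
  have h1 : (ascPochhammer ℝ j).eval (ε + 1 / 2 : ℝ) ≠ 0 :=
    (ascPochhammer_pos j _ (by positivity)).ne'
  rw [show m + 1 - 1 - j = m - j by omega,
    show 2 * m + ε - 2 * (m - j) = 2 * j + ε by omega,
    show 2 * m + ε - (m - j) = m + ε + j by omega, prod_range_add_X_add_C,
    factorial_two_mul_add ε j hε, coe_compRingHom_apply, meixnerTerm, mul_comp, mul_comp, C_comp,
    C_comp]
  have h2 : ((m.choose j : ℕ) : ℝ) = m.factorial / (j.factorial * (m - j).factorial) :=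
    Nat.cast_choose ℝ hj
  have h3 : ((-1 : ℝ)) ^ m = (-1) ^ (m - j) * (-1) ^ j := by rw [← pow_add, Nat.sub_add_cancel hj]
  have h4 : ((-1 : ℝ)) ^ j * (-1) ^ j = 1 := by rw [← mul_pow]; simp
  have h5 : (-1) ^ (m - j) / ((m - j).factorial * (4 ^ j * j.factorial *
        (ascPochhammer ℝ j).eval (ε + 1 / 2 : ℝ)) : ℝ) * (2 * x) ^ (2 * j + ε)
      = (-1) ^ m * (2 * x) ^ ε / m.factorial * (m.choose j : ℝ) *
        ((-(x ^ 2)) ^ j / (ascPochhammer ℝ j).eval (ε + 1 / 2 : ℝ)) := by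
    have h6 : (2 * x) ^ (2 * j + ε) = 4 ^ j * (x ^ 2) ^ j * (2 * x) ^ ε := by
      rw [pow_add, pow_mul, mul_pow, mul_pow]; norm_num
    have hm := Nat.cast_ne_zero (R := ℝ).2 m.factorial_ne_zero
    have hj' := Nat.cast_ne_zero (R := ℝ).2 j.factorial_ne_zero
    have hmj := Nat.cast_ne_zero (R := ℝ).2 (m - j).factorial_ne_zero
    rw [h2, h3, h6, neg_pow (x ^ 2) j]
    generalize (ascPochhammer ℝ j).eval (ε + 1 / 2 : ℝ) = P at h1 ⊢
    field_simp
    linear_combination (-(2 * x) ^ ε * (x ^ 2) ^ j) * h4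
  rw [h5]
  simp only [C_mul]
  ring

theorem prod_range_X_add_C_eq_multiset_prod (k : ℕ) :
    ∏ i ∈ Finset.range k, (X + C (i : ℝ))
      = (((Multiset.range k).map (fun j : ℕ => -(j : ℝ))).map fun s => X - C s).prod := by
  rw [Multiset.map_map, Finset.prod_eq_multiset_prod, Finset.range_val]
  simp

theorem mainTheorem1 (n : ℕ) :
    -- real-rootedness in `z` for every `x ∈ [-1, 1]`, with degree exactly `n` unless `x = 0`
    (∀ x ∈ Set.Icc (-1 : ℝ) 1, (gegenbauerInParam n x).Splits) ∧
    (∀ x ∈ Set.Icc (-1 : ℝ) 1, x ≠ 0 → (gegenbauerInParam n x).degree = (n : WithBot ℕ)) ∧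
    -- the case `x = 0`
    (Even n →
      (gegenbauerInParam n 0).degree = ((n / 2 : ℕ) : WithBot ℕ) ∧
      (gegenbauerInParam n 0).roots
        = (Multiset.range (n / 2)).map (fun j : ℕ => -(j : ℝ))) ∧
    (Odd n → gegenbauerInParam n 0 = 0) ∧
    -- for `x ≠ 0`: the `⌈n/2⌉` constant roots and the `⌊n/2⌋` moving ones
    ∃ γ : Fin (n / 2) → ℝ → ℝ,
      (∀ x ∈ Set.Icc (-1 : ℝ) 1, x ≠ 0 →
        (gegenbauerInParam n x).roots
          = (Multiset.range ((n + 1) / 2)).map (fun j : ℕ => -(j : ℝ))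
            + Finset.univ.val.map (fun i : Fin (n / 2) => γ i x)) ∧
      (∀ x ∈ Set.Icc (-1 : ℝ) 1, x ≠ 0 → Function.Injective fun i : Fin (n / 2) => γ i x) ∧
      ∀ i : Fin (n / 2),
        ContinuousOn (γ i) (Set.Ico (-1) 0) ∧ ContinuousOn (γ i) (Set.Ioc 0 1) ∧
        StrictMonoOn (γ i) (Set.Ico (-1) 0) ∧ StrictAntiOn (γ i) (Set.Ioc 0 1) ∧
        Tendsto (γ i) (𝓝[<] 0) atTop ∧ Tendsto (γ i) (𝓝[>] 0) atTop := by
  obtain ⟨m, ε, hm, hε, hn, hceil⟩ : ∃ m ε : ℕ, n / 2 = m ∧ ε ≤ 1 ∧ n = 2 * m + ε ∧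
      (n + 1) / 2 = m + ε := ⟨n / 2, n % 2, rfl, by omega, by omega, by omega⟩
  rw [hm, hceil]
  clear hm hceil
  have hc : (0 : ℝ) < ε + 1 / 2 := by positivity
  have hG := fun x => gegenbauerInParam_two_mul_add m ε hε x
  rw [← hn] at hG
  obtain ⟨r, hr, hp, hcurve⟩ := exists_root_curves_meixner hc m
  have hsq : ∀ x ∈ Set.Icc (-1 : ℝ) 1, x ≠ 0 → x ^ 2 ∈ Set.Ioc (0 : ℝ) 1 := fun x hx hx0 =>
    ⟨by positivity, by nlinarith [hx.1, hx.2]⟩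
  let γ : Fin m → ℝ → ℝ := fun i x => r i (x ^ 2) - (m + ε : ℕ)
  have hfac : ∀ x ∈ Set.Icc (-1 : ℝ) 1, x ≠ 0 → ∃ K : ℝ, K ≠ 0 ∧ gegenbauerInParam n x
      = C K * (((Multiset.range (m + ε)).map (fun j : ℕ => -(j : ℝ))
        + Finset.univ.val.map (fun i => γ i x)).map fun s => X - C s).prod := by
    intro x hx hx0
    have ht := hsq x hx hx0
    have hlead : (meixner (ε + 1 / 2) (x ^ 2) m).leadingCoeff ≠ 0 := fun h => by
      have hdeg := natDegree_meixner hc ht.1.ne' m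
      rw [leadingCoeff_eq_zero.1 h, natDegree_zero] at hdeg
      subst hdeg
      simp [meixner_zero] at h
    refine ⟨(-1) ^ m * (2 * x) ^ ε / m.factorial *
      (meixner (ε + 1 / 2) (x ^ 2) m).leadingCoeff, by positivity, ?_⟩
    have hmul : ∀ (a b : ℝ) (P Q : ℝ[X]), C a * P * (C b * Q) = C (a * b) * (P * Q) :=
      fun a b P Q => by rw [C_mul]; ring
    have hcomp : (∏ i, (X - C (r i (x ^ 2)))).comp (X + C ((m + ε : ℕ) : ℝ))
        = ((Finset.univ.val.map fun i => γ i x).map fun s => X - C s).prod := by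
      rw [prod_comp, Multiset.map_map, Finset.prod_eq_multiset_prod]
      refine congrArg Multiset.prod (Multiset.map_congr rfl fun i _ => ?_)
      simp only [sub_comp, X_comp, C_comp, Function.comp, γ, C_sub]
      ring
    rw [Multiset.map_add, Multiset.prod_add, ← prod_range_X_add_C_eq_multiset_prod, ← hcomp,
      ← hmul, hG x]
    conv_lhs => rw [hp _ ht, mul_comp, C_comp]
  have hdegree : ∀ (K : ℝ) (s : Multiset ℝ), K ≠ 0 →
      (C K * (s.map fun a => X - C a).prod).degree = (s.card : WithBot ℕ) := fun K s hK => by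
    rw [degree_C_mul hK, degree_eq_natDegree (monic_multisetProd_X_sub_C s).ne_zero,
      natDegree_multiset_prod_X_sub_C_eq_card]
  have hroots : ∀ (K : ℝ) (s : Multiset ℝ), K ≠ 0 →
      (C K * (s.map fun a => X - C a).prod).roots = s := fun K s hK => by
    rw [roots_C_mul _ hK, roots_multiset_prod_X_sub_C]
  have hzero_even : ε = 0 → gegenbauerInParam n 0 = C ((-1 : ℝ) ^ m / m.factorial) *
      (((Multiset.range m).map (fun j : ℕ => -(j : ℝ))).map fun s => X - C s).prod := by
    rintro rfl
    rw [hG, ← prod_range_X_add_C_eq_multiset_prod]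
    have h1 : meixner ((0 : ℕ) + 1 / 2) ((0 : ℝ) ^ 2) m = 1 := by
      refine funext fun w => ?_
      rw [zero_pow two_ne_zero, eval_meixner_arg_zero, eval_one]
    rw [h1]
    simp
  have hzero_odd : ε = 1 → gegenbauerInParam n 0 = 0 := by
    rintro rfl
    rw [hG]
    simp
  have hK₀ : (-1 : ℝ) ^ m / m.factorial ≠ 0 := by positivity
  have hsplits : ∀ s : Multiset ℝ, (s.map fun a => X - C a).prod.Splits := fun s =>
    Splits.multisetProd fun f hf => by
      obtain ⟨a, -, rfl⟩ := Multiset.mem_map.1 hf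
      exact Splits.X_sub_C a
  refine ⟨fun x hx => ?_, fun x hx hx0 => ?_, fun hev => ?_, fun hodd => ?_, γ, fun x hx hx0 => ?_,
    fun x hx hx0 i j hij => ?_, fun i => ?_⟩
  · by_cases hx0 : x = 0
    · subst hx0
      rcases (show ε = 0 ∨ ε = 1 by omega) with h | h
      · rw [hzero_even h]
        exact (hsplits _).C_mul _
      · rw [hzero_odd h]
        exact Splits.zero
    · obtain ⟨K, -, h⟩ := hfac x hx hx0
      rw [h]
      exact (hsplits _).C_mul _
  · obtain ⟨K, hK, h⟩ := hfac x hx hx0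
    rw [h, hdegree K _ hK, hn]
    simp
    ring
  · rw [hzero_even (by rw [Nat.even_iff] at hev; omega), hdegree _ _ hK₀, hroots _ _ hK₀]
    simp
  · exact hzero_odd (by rw [Nat.odd_iff] at hodd; omega)
  · obtain ⟨K, hK, h⟩ := hfac x hx hx0
    rw [h, hroots K _ hK]
  · exact (hr _ (hsq x hx hx0)).injective (sub_left_injective hij)
  · obtain ⟨h1, h2, h3⟩ := hcurve i
    have hneg : Set.MapsTo (fun x : ℝ => x ^ 2) (Set.Ico (-1) 0) (Set.Ioc 0 1) := fun x hx =>
      hsq x ⟨hx.1, by linarith [hx.2]⟩ hx.2.ne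
    have hpos : Set.MapsTo (fun x : ℝ => x ^ 2) (Set.Ioc 0 1) (Set.Ioc 0 1) := fun x hx =>
      hsq x ⟨by linarith [hx.1], hx.2⟩ hx.1.ne'
    have hlim : ∀ l : Filter ℝ, l ≤ 𝓝[≠] 0 → Tendsto (γ i) l atTop := fun l hl => by
      refine tendsto_atTop_add_const_right _ _ (h3.comp (tendsto_nhdsWithin_iff.2 ⟨?_, ?_⟩))
      · have h : Tendsto (fun x : ℝ => x ^ 2) (𝓝 0) (𝓝 (0 ^ 2)) := (continuous_pow 2).tendsto 0
        rw [zero_pow two_ne_zero] at h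
        exact h.mono_left (hl.trans nhdsWithin_le_nhds)
      · filter_upwards [hl self_mem_nhdsWithin] with x hx
        have : x ≠ 0 := hx
        exact Set.mem_Ioi.2 (by positivity)
    refine ⟨(h1.comp (by fun_prop) hneg).sub continuousOn_const,
      (h1.comp (by fun_prop) hpos).sub continuousOn_const, fun x hx y hy hxy => ?_,
      fun x hx y hy hxy => ?_, hlim _ (nhdsWithin_mono _ fun x hx => ?_),
      hlim _ (nhdsWithin_mono _ fun x hx => ?_)⟩
    · exact sub_lt_sub_right (h2 (hneg hy) (hneg hx) (by nlinarith [hx.2, hy.2])) _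
    · exact sub_lt_sub_right (h2 (hpos hx) (hpos hy) (by nlinarith [hx.1, hy.1])) _
    · exact ne_of_lt hx
    · exact ne_of_gt hx
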